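/- Let $n\ge 1$, let $\Omega\subset\mathbb R^n$ be a bounded Lipschitz domain (a nonempty bounded open set with Lipschitz boundary), and let $V=H^1(\Omega)$ with its usual norm. Let $f\in L^2(\Omega)$, $h\in H^{1/2}(\partial\Omega)$ and $\psi\in H^1(\Omega)$ with $\psi\le h$ a.e. on $\partial\Omega$, and set $$K=\{u\in H^1(\Omega): u\ge\psi \text{ a.e. in }\Omega,\ u=h\text{ on }\partial\Omega\},$$ where boundary values are understood in the sense of traces. Let $A\colon V\to V^*$ satisfy, with constants $C_a,C_b>0$, $\|Au-Av\|_{V^*}\le C_b\|u-v\|_V$ and $\langle Au-Av,u-v\rangle\ge C_a\|u-v\|_V^2$ for all $u,v\in K$ (for example, subject to the coercivity on $K$, $A=-\Delta+\sum_i b_i\partial_{x_i}+k\,\mathrm{Id}$ in weak form with constants $b_i,k\ge0$), and let $\gamma>\frac1{2C_a}$. Let $u^*\in K$ solve the variational inequality $\langle Au^*-f,u^*-v\rangle\le0$ for all $v\in K$. Let $X,Y\subset V$ satisfy $u^*\in X\cap Y$, $K\cap X\subset K\cap Y$, with $K\cap Y$ convex and closed in $V$. For $u,v\in V$ put $$L_\gamma(u,v)=\langle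 Au-f,u-v\rangle-\tfrac1{2\gamma}\|u-v\|_V^2,\qquad G_\gamma(u)=\sup_{v\in K\cap Y}L_\gamma(u,v),$$ $$L_o(v)=\int_\Omega|(\psi-v)^+|^2,\qquad L_b(v)=\int_{\partial\Omega}|v-h|^2,\qquad R_i(v)=w_{b_i}L_b(v)+w_{o_i}L_o(v)\quad(i=1,2),$$ with penalty weights $w_{o_i},w_{b_i}$, and for a nonempty set $X^{\mathrm t}\subset V$ of test functions put $$H_\gamma(u)=\sup_{v\in X^{\mathrm t}}\bigl(L_\gamma(u,v)+R_1(u)-R_2(v)\bigr).$$ Then the following hold. 1. For all $w_{o_2},w_{b_2}\ge0$ the functional $L_\gamma(u^*,\cdot)-R_2$ has exactly one maximiser $v^*=v^*(w_{o_2},w_{b_2})$ over $H^1(\Omega)$. 2. For every $\varepsilon>0$ there is $\alpha_0>0$, independent of $X^{\mathrm t}$, $w_{o_1}$ and $w_{b_1}$, such that $\min(w_{o_2},w_{b_2})\ge\alpha_0$ implies $$H_\gamma(u^*)-G_\gamma(u^*)\le\varepsilon-\frac1{2\gamma}\|u^*-v^*\|_V^2-R_2(v^*).$$ 3. There is exactly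 one maximiser $\hat v$ of $L_\gamma(u^*,\cdot)$ over $K$, and $v^*(w_{o_2},w_{b_2})\to\hat v$ strongly in $H^1(\Omega)$ as $w_{o_2},w_{b_2}\to\infty$. 4. There is a constant $C$, independent of the weights, such that for every $\alpha>0$ and all weights with $\min(w_{o_2},w_{b_2})\ge\alpha$, $$\|(\psi-v^*)^+\|_{L^2(\Omega)}\le\frac{C}{\sqrt\alpha},\qquad \|v^*-h\|_{L^2(\partial\Omega)}\le\frac{C}{\sqrt\alpha}.$$ -/

import Mathlib

open MeasureTheory Set Filter Topology
open scoped ENNReal NNReal ContDiff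

noncomputable section

namespace ObstacleVI

/-- The Euclidean space `ℝⁿ`. -/
abbrev Eucl (n : ℕ) : Type := EuclideanSpace ℝ (Fin n)

variable {n : ℕ}

/-- `Ω` has a Lipschitz boundary: near each boundary point, `Ω` is, in the orthogonal coordinates
given by some unit vector `e` and its orthogonal complement, the open region strictly above the
graph of a Lipschitz function. -/
def HasLipschitzBoundary (Ω : Set (Eucl n)) : Prop :=
  ∀ x ∈ frontier Ω, ∃ r > 0, ∃ e : Eucl n, ‖e‖ = 1 ∧
    ∃ (C : ℝ≥0) (g : (Submodule.span ℝ {e})ᗮ → ℝ), LipschitzWith C g ∧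
      ∀ y ∈ Metric.ball x r,
        (y ∈ Ω ↔ g ((Submodule.span ℝ {e})ᗮ.orthogonalProjectionOnto y) < inner ℝ e y)

/-- A bounded Lipschitz domain: a nonempty bounded open set with Lipschitz boundary. -/
structure IsBoundedLipschitzDomain (Ω : Set (Eucl n)) : Prop where
  nonempty : Ω.Nonempty
  isOpen : IsOpen Ω
  isBounded : Bornology.IsBounded Ω
  lipschitz : HasLipschitzBoundary Ω

/-- Real-valued `L²(Ω)`. -/
abbrev L2 (Ω : Set (Eucl n)) := Lp ℝ 2 (volume.restrict Ω)

/-- The square integrable vector fields `L²(Ω; ℝⁿ)`. -/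
abbrev L2Vec (Ω : Set (Eucl n)) := Lp (Eucl n) 2 (volume.restrict Ω)

/-- The surface measure on `∂Ω`: the (normalised) `(n-1)`-dimensional Hausdorff measure. -/
def surface (Ω : Set (Eucl n)) : Measure (Eucl n) :=
  (Measure.euclideanHausdorffMeasure (n - 1)).restrict (frontier Ω)

/-- Real-valued `L²(∂Ω)`. -/
abbrev L2Boundary (Ω : Set (Eucl n)) := Lp ℝ 2 (surface Ω)

/-- `g` is the weak gradient of `u` on `Ω`. -/
def IsWeakGradient (Ω : Set (Eucl n)) (u : L2 Ω) (g : L2Vec Ω) : Prop :=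
  ∀ φ : Eucl n → ℝ, ContDiff ℝ ∞ φ → HasCompactSupport φ → tsupport φ ⊆ Ω →
    ∫ x in Ω, u x • gradient φ x = -∫ x in Ω, φ x • g x

lemma integrable_smul_gradient (Ω : Set (Eucl n)) (u : L2 Ω) {φ : Eucl n → ℝ}
    (hφ : ContDiff ℝ ∞ φ) (hc : HasCompactSupport φ) :
    Integrable (fun x => u x • gradient φ x) (volume.restrict Ω) := by
  have h1 : Continuous (gradient φ) :=
    (InnerProductSpace.toDual ℝ (Eucl n)).symm.continuous.comp
      (hφ.continuous_fderiv (by simp))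
  have h2 : HasCompactSupport (gradient φ) :=
    (hc.fderiv (𝕜 := ℝ)).comp_left
      (g := (InnerProductSpace.toDual ℝ (Eucl n)).symm) (map_zero _)
  have h3 : MemLp (gradient φ) 2 (volume.restrict Ω) := h1.memLp_of_hasCompactSupport h2
  exact memLp_one_iff_integrable.mp (h3.smul (Lp.memLp u))

lemma integrable_smul_field (Ω : Set (Eucl n)) (g : L2Vec Ω) {φ : Eucl n → ℝ}
    (hφ : ContDiff ℝ ∞ φ) (hc : HasCompactSupport φ) :
    Integrable (fun x => φ x • g x) (volume.restrict Ω) := by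
  have h3 : MemLp φ 2 (volume.restrict Ω) := hφ.continuous.memLp_of_hasCompactSupport hc
  exact memLp_one_iff_integrable.mp ((Lp.memLp g).smul h3)

/-- The Sobolev space `V = H¹(Ω)`. A member is stored as the pair of an `L²` function and its
(unique) weak gradient; the norm inherited from the `ℓ²`-product is the usual one,
`‖u‖² = ‖u‖²_{L²(Ω)} + ‖∇u‖²_{L²(Ω)}`. -/
def sobolevH1 (Ω : Set (Eucl n)) : Submodule ℝ (WithLp 2 (L2 Ω × L2Vec Ω)) where
  carrier := {p | IsWeakGradient Ω p.fst p.snd}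
  zero_mem' := by
    intro φ hφ hc hs
    have e1 : (fun x => ((0 : L2 Ω) : Eucl n → ℝ) x • gradient φ x)
        =ᵐ[volume.restrict Ω] fun _ => 0 := by
      filter_upwards [Lp.coeFn_zero ℝ 2 (volume.restrict Ω)] with x hx
      simp only [hx, Pi.zero_apply, zero_smul]
    have e2 : (fun x => φ x • ((0 : L2Vec Ω) : Eucl n → Eucl n) x)
        =ᵐ[volume.restrict Ω] fun _ => 0 := by
      filter_upwards [Lp.coeFn_zero (Eucl n) 2 (volume.restrict Ω)] with x hx
      simp only [hx, Pi.zero_apply, smul_zero]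
    simp only [WithLp.zero_fst, WithLp.zero_snd]
    rw [integral_congr_ae e1, integral_congr_ae e2]
    simp
  add_mem' := by
    intro p q hp hq φ hφ hc hs
    have e1 : (fun x => (p.fst + q.fst : L2 Ω) x • gradient φ x)
        =ᵐ[volume.restrict Ω] fun x => p.fst x • gradient φ x + q.fst x • gradient φ x := by
      filter_upwards [Lp.coeFn_add p.fst q.fst] with x hx
      simp only [hx, Pi.add_apply, add_smul]
    have e2 : (fun x => φ x • (p.snd + q.snd : L2Vec Ω) x)
        =ᵐ[volume.restrict Ω] fun x => φ x • p.snd x + φ x • q.snd x := by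
      filter_upwards [Lp.coeFn_add p.snd q.snd] with x hx
      simp only [hx, Pi.add_apply, smul_add]
    simp only [WithLp.add_fst, WithLp.add_snd]
    rw [integral_congr_ae e1, integral_congr_ae e2,
      integral_add (integrable_smul_gradient Ω _ hφ hc) (integrable_smul_gradient Ω _ hφ hc),
      integral_add (integrable_smul_field Ω _ hφ hc) (integrable_smul_field Ω _ hφ hc),
      hp φ hφ hc hs, hq φ hφ hc hs, neg_add]
  smul_mem' := by
    intro c p hp φ hφ hc hs
    have e1 : (fun x => (c • p.fst : L2 Ω) x • gradient φ x)
        =ᵐ[volume.restrict Ω] fun x => c • (p.fst x • gradient φ x) := by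
      filter_upwards [Lp.coeFn_smul c p.fst] with x hx
      simp only [hx, Pi.smul_apply, smul_eq_mul, mul_smul]
    have e2 : (fun x => φ x • (c • p.snd : L2Vec Ω) x)
        =ᵐ[volume.restrict Ω] fun x => c • (φ x • p.snd x) := by
      filter_upwards [Lp.coeFn_smul c p.snd] with x hx
      rw [hx, Pi.smul_apply, smul_comm]
    simp only [WithLp.smul_fst, WithLp.smul_snd]
    rw [integral_congr_ae e1, integral_congr_ae e2, integral_smul, integral_smul,
      hp φ hφ hc hs, smul_neg]

/-- `V = H¹(Ω)` as a type. -/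
abbrev H1 (Ω : Set (Eucl n)) : Type := ↥(sobolevH1 Ω)

/-- The underlying `L²(Ω)` function of `u ∈ H¹(Ω)`. -/
def H1.fn {Ω : Set (Eucl n)} (u : H1 Ω) : L2 Ω := (u : WithLp 2 (L2 Ω × L2Vec Ω)).fst

/-- The dual space `V*`. -/
abbrev DualH1 (Ω : Set (Eucl n)) := StrongDual ℝ (H1 Ω)

/-- `T` extends the restriction `φ ↦ φ|_{∂Ω}` of smooth functions `φ ∈ C^∞(closure Ω)`. -/
def ExtendsRestriction (Ω : Set (Eucl n)) (T : H1 Ω →L[ℝ] L2Boundary Ω) : Prop :=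
  ∀ φ : Eucl n → ℝ, ContDiff ℝ ∞ φ → HasCompactSupport φ → ∀ u : H1 Ω,
    u.fn =ᵐ[volume.restrict Ω] φ → T u =ᵐ[surface Ω] φ

open Classical in
/-- The trace operator `H¹(Ω) → L²(∂Ω)`: the continuous linear operator that extends the
restriction of smooth functions to the boundary. On a bounded Lipschitz domain there is exactly
one such operator (by the trace theorem and the density of smooth functions). -/
def trace (Ω : Set (Eucl n)) : H1 Ω →L[ℝ] L2Boundary Ω :=
  if h : ∃ T, ExtendsRestriction Ω T then h.choose else 0

/-- `H^{1/2}(∂Ω)`, the space of boundary values of `H¹(Ω)` functions. -/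
def HHalf (Ω : Set (Eucl n)) : Submodule ℝ (L2Boundary Ω) := (trace Ω).toLinearMap.range

/-- The constraint set `K = {u ∈ H¹(Ω) | u ≥ ψ in Ω, u = h on ∂Ω}`. -/
def constraintSet (Ω : Set (Eucl n)) (ψ : H1 Ω) (h : L2Boundary Ω) : Set (H1 Ω) :=
  {u | (∀ᵐ x ∂(volume.restrict Ω), ψ.fn x ≤ u.fn x) ∧ trace Ω u = h}

section Functionals

variable {Ω : Set (Eucl n)}

/-- `L(u, v) = ⟨Au - f, u - v⟩`, where `f ∈ L²(Ω)` acts by integration. -/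
def lagr (A : H1 Ω → DualH1 Ω) (f : L2 Ω) (u v : H1 Ω) : ℝ :=
  A u (u - v) - ∫ x in Ω, f x * (u - v).fn x

/-- `u` solves the variational inequality: `u ∈ K` and `⟨Au - f, u - v⟩ ≤ 0` for all `v ∈ K`. -/
def SolvesVI (K : Set (H1 Ω)) (A : H1 Ω → DualH1 Ω) (f : L2 Ω) (u : H1 Ω) : Prop :=
  u ∈ K ∧ ∀ v ∈ K, lagr A f u v ≤ 0

/-- `L_γ(u, v) = L(u, v) - ‖u - v‖²_V / (2γ)`. -/
def lagrReg (A : H1 Ω → DualH1 Ω) (f : L2 Ω) (γ : ℝ) (u v : H1 Ω) : ℝ :=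
  lagr A f u v - 1 / (2 * γ) * ‖u - v‖ ^ 2

/-- The regularised gap function `G_γ(u) = sup_{v ∈ K ∩ Y} L_γ(u, v)`. -/
def gap (K Y : Set (H1 Ω)) (A : H1 Ω → DualH1 Ω) (f : L2 Ω) (γ : ℝ) (u : H1 Ω) : ℝ :=
  sSup (lagrReg A f γ u '' (K ∩ Y))

/-- The obstacle loss `L_o(u) = ∫_Ω |(ψ - u)⁺|²`. -/
def obstacleLoss (ψ u : H1 Ω) : ℝ := ∫ x in Ω, (max (ψ.fn x - u.fn x) 0) ^ 2

/-- The boundary loss `L_b(u) = ∫_{∂Ω} |u - h|²`, with `u` understood through its trace. -/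
def boundaryLoss (h : L2Boundary Ω) (u : H1 Ω) : ℝ := ∫ x, (trace Ω u x - h x) ^ 2 ∂(surface Ω)

/-- The penalty `R(u) = w_b L_b(u) + w_o L_o(u)`. -/
def penalty (ψ : H1 Ω) (h : L2Boundary Ω) (wo wb : ℝ) (u : H1 Ω) : ℝ :=
  wb * boundaryLoss h u + wo * obstacleLoss ψ u

/-- `H_γ(u) = sup_{v ∈ Xt} (L_γ(u, v) + R₁(u) - R₂(v))`, with the weights `wo₁, wb₁` in `R₁` and
`wo₂, wb₂` in `R₂`. -/
def gapPen (Xt : Set (H1 Ω)) (A : H1 Ω → DualH1 Ω) (f : L2 Ω) (γ : ℝ) (ψ : H1 Ω)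
    (h : L2Boundary Ω) (wo₁ wb₁ wo₂ wb₂ : ℝ) (u : H1 Ω) : ℝ :=
  sSup ((fun v => lagrReg A f γ u v + penalty ψ h wo₁ wb₁ u - penalty ψ h wo₂ wb₂ v) '' Xt)

/-- `v` maximises `w ↦ L_γ(u, w) - R₂(w)` over all of `H¹(Ω)`. -/
def IsPenalisedMaximiser (A : H1 Ω → DualH1 Ω) (f : L2 Ω) (γ : ℝ) (ψ : H1 Ω)
    (h : L2Boundary Ω) (wo₂ wb₂ : ℝ) (u v : H1 Ω) : Prop :=
  IsMaxOn (fun w => lagrReg A f γ u w - penalty ψ h wo₂ wb₂ w) univ v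

end Functionals

end ObstacleVI

end

namespace ObstacleVI

/-! By Riesz representation and completing the square, `lagrReg` at `uStar` is a constant minus `c *
‖v - p‖ ^ 2` with `c = 1 / (2 * γ)` (`exists_lagrReg_eq_sub_sq`). Maximising it minus the penalty
means minimising a strongly convex energy on a Hilbert space, so minimisers exist with quadratic
growth (`exists_minimiser_quadratic_growth`), which also gives uniqueness.

The constraint set is the common zero set of the two convex, continuous, nonnegative losses. The
minimal penalised energy increases with the weights and is bounded by the energy at `z`, the
constrained minimiser. Quadratic growth then makes the minimisers Cauchy, and their limit must be
`z` (`exists_penalty_minimisers_tendsto`). The same energy bound gives the violation rate.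

For the gap estimate, the supremum over test functions is at most the maximum over the whole space.
Its linear part at `V` tends to that at `z`, which is nonpositive by the variational inequality,
while the gap at `uStar` is nonnegative. -/

lemma eq_of_half_mul_norm_sub_sq_le {E : Type*} [NormedAddCommGroup E] {c : ℝ} (hc : 0 < c)
    {v w : E} (h : c / 2 * ‖v - w‖ ^ 2 ≤ 0) : v = w := by
  have h1 : ‖v - w‖ ^ 2 ≤ 0 := by
    have h2 : c / 2 * ‖v - w‖ ^ 2 ≤ c / 2 * 0 := by linarith
    exact le_of_mul_le_mul_left h2 (by positivity)
  exact sub_eq_zero.1 (norm_eq_zero.1 (pow_eq_zero_iff two_ne_zero |>.1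
    (le_antisymm h1 (sq_nonneg _))))

/-! ### Penalised projection in a Hilbert space. -/

section Hilbert

variable {E : Type*} [NormedAddCommGroup E] [InnerProductSpace ℝ E]

lemma midpoint_norm_sub_sq (v w p : E) :
    ‖(1 / 2 : ℝ) • v + (1 / 2 : ℝ) • w - p‖ ^ 2
      = (‖v - p‖ ^ 2 + ‖w - p‖ ^ 2) / 2 - ‖w - v‖ ^ 2 / 4 := by
  have e : (1 / 2 : ℝ) • v + (1 / 2 : ℝ) • w - p = (1 / 2 : ℝ) • ((v - p) + (w - p)) := by
    module
  have h := parallelogram_law_with_norm ℝ (v - p) (w - p)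
  have e2 : (v - p) - (w - p) = -(w - v) := by abel
  rw [e2, norm_neg] at h
  rw [e, norm_smul, mul_pow]
  norm_num
  nlinarith

/-- Completing the square; the maximum over `w` is at `γ • g`. -/
lemma inner_sub_mul_norm_sq {γ : ℝ} (hγ : 0 < γ) (g w : E) :
    inner ℝ g w - 1 / (2 * γ) * ‖w‖ ^ 2
      = γ / 2 * ‖g‖ ^ 2 - 1 / (2 * γ) * ‖γ • g - w‖ ^ 2 := by
  rw [norm_sub_sq_real, norm_smul, real_inner_smul_left, Real.norm_of_nonneg hγ.le]
  field_simp
  ring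

/-- A convex perturbation of a squared distance satisfies the midpoint form of strong convexity. -/
lemma midpoint_strong_convexity {c : ℝ} (p : E) {R : E → ℝ} (hR : ConvexOn ℝ univ R) (v w : E) :
    c * ‖(1 / 2 : ℝ) • v + (1 / 2 : ℝ) • w - p‖ ^ 2 + R ((1 / 2 : ℝ) • v + (1 / 2 : ℝ) • w)
      ≤ ((c * ‖v - p‖ ^ 2 + R v) + (c * ‖w - p‖ ^ 2 + R w)) / 2 - c / 4 * ‖w - v‖ ^ 2 := by
  have h := hR.2 (mem_univ v) (mem_univ w) (by norm_num : (0 : ℝ) ≤ 1 / 2)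
    (by norm_num : (0 : ℝ) ≤ 1 / 2) (by norm_num)
  simp only [smul_eq_mul] at h
  rw [midpoint_norm_sub_sq]
  linarith

/-- A nonnegative, convex, continuous perturbation of a squared distance has a minimiser on every
nonempty closed convex set, with quadratic growth around it. -/
lemma exists_minimiser_quadratic_growth [CompleteSpace E] {c : ℝ} (hc : 0 < c) (p : E)
    {R : E → ℝ} (hR : ConvexOn ℝ univ R) (hRc : Continuous R) (hR0 : ∀ v, 0 ≤ R v)
    {S : Set E} (hS : S.Nonempty) (hSconv : Convex ℝ S) (hScl : IsClosed S) :
    ∃ v ∈ S, ∀ w ∈ S,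
      c * ‖v - p‖ ^ 2 + R v + c / 2 * ‖w - v‖ ^ 2 ≤ c * ‖w - p‖ ^ 2 + R w := by
  set φ : E → ℝ := fun v => c * ‖v - p‖ ^ 2 + R v with hφ
  have hφc : Continuous φ := by fun_prop
  have hφ0 : ∀ v, 0 ≤ φ v := fun v => add_nonneg (by positivity) (hR0 v)
  have hbdd : BddBelow (φ '' S) := ⟨0, by rintro _ ⟨v, -, rfl⟩; exact hφ0 v⟩
  set m := sInf (φ '' S) with hm
  have hle : ∀ v ∈ S, m ≤ φ v := fun v hv => csInf_le hbdd (mem_image_of_mem φ hv)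
  have hmid : ∀ v ∈ S, ∀ w ∈ S, m ≤ (φ v + φ w) / 2 - c / 4 * ‖w - v‖ ^ 2 := fun v hv w hw =>
    (hle _ (hSconv hv hw (by norm_num) (by norm_num) (by norm_num))).trans
      (midpoint_strong_convexity p hR v w)
  have hex : ∀ k : ℕ, ∃ v ∈ S, φ v < m + 1 / ((k : ℝ) + 1) := fun k => by
    obtain ⟨_, ⟨v, hv, rfl⟩, hlt⟩ := exists_lt_of_csInf_lt (hS.image φ)
      (lt_add_of_pos_right m (Nat.one_div_pos_of_nat (α := ℝ) (n := k)))
    exact ⟨v, hv, hlt⟩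
  choose s hs hsm using hex
  have hlim0 : Tendsto (fun k : ℕ => 1 / ((k : ℝ) + 1)) atTop (𝓝 0) :=
    tendsto_one_div_add_atTop_nhds_zero_nat
  have hcau : CauchySeq s := by
    -- Two points with energy within `1 / (N + 1)` of the infimum satisfy `c / 4 * ‖·‖ ^ 2 ≤ 1 / (N
    -- + 1)` by `hmid`.
    refine cauchySeq_of_le_tendsto_0 (fun N : ℕ => √(4 / c * (1 / ((N : ℝ) + 1)))) ?_ ?_
    · intro k l N hk hl
      rw [dist_comm, dist_eq_norm]
      apply Real.le_sqrt_of_sq_le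
      have h1 := hmid _ (hs k) _ (hs l)
      have h2 : φ (s k) < m + 1 / ((N : ℝ) + 1) :=
        (hsm k).trans_le (by gcongr)
      have h3 : φ (s l) < m + 1 / ((N : ℝ) + 1) :=
        (hsm l).trans_le (by gcongr)
      rw [div_mul_eq_mul_div, le_div_iff₀ hc]
      linarith
    · have := (hlim0.const_mul (4 / c)).sqrt
      simpa using this
  obtain ⟨v, hv⟩ := cauchySeq_tendsto_of_complete hcau
  have hvS : v ∈ S := hScl.mem_of_tendsto hv (Eventually.of_forall hs)
  have hvm : φ v ≤ m := by
    refine le_of_tendsto_of_tendsto' ((hφc.tendsto v).comp hv)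
      (by simpa using hlim0.const_add m : Tendsto (fun k : ℕ => m + 1 / ((k : ℝ) + 1)) atTop (𝓝 m))
      fun k => (hsm k).le
  refine ⟨v, hvS, fun w hw => ?_⟩
  have h1 := hmid v hvS w hw
  change φ v + c / 2 * ‖w - v‖ ^ 2 ≤ φ w
  linarith

/-- Minimisers of a squared distance plus two weighted penalties converge, as the weights tend to
infinity, to the minimiser of the squared distance over the common zero set of the penalties. -/
lemma exists_penalty_minimisers_tendsto [CompleteSpace E] {c : ℝ} (hc : 0 < c) (p : E)
    {F G : E → ℝ} (hF : ConvexOn ℝ univ F) (hFc : Continuous F) (hF0 : ∀ v, 0 ≤ F v)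
    (hG : ConvexOn ℝ univ G) (hGc : Continuous G) (hG0 : ∀ v, 0 ≤ G v)
    {K : Set E} (hKmem : ∀ v, v ∈ K ↔ F v = 0 ∧ G v = 0) (hK : K.Nonempty) :
    ∃ V : ℝ → ℝ → E,
      (∀ a b : ℝ, 0 ≤ a → 0 ≤ b → ∀ w,
        c * ‖V a b - p‖ ^ 2 + (b * G (V a b) + a * F (V a b)) + c / 2 * ‖w - V a b‖ ^ 2
          ≤ c * ‖w - p‖ ^ 2 + (b * G w + a * F w)) ∧
      ∃ z ∈ K, (∀ w ∈ K, c * ‖z - p‖ ^ 2 + c / 2 * ‖w - z‖ ^ 2 ≤ c * ‖w - p‖ ^ 2) ∧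
        Tendsto (fun w : ℝ × ℝ => V w.1 w.2) atTop (𝓝 z) := by
  have hKeq : K = {v | F v ≤ 0} ∩ {v | G v ≤ 0} := by
    ext v
    simp only [hKmem, mem_inter_iff, mem_ofPred_eq, (hF0 v).ge_iff_eq', (hG0 v).ge_iff_eq']
  have hKconv : Convex ℝ K := by
    rw [hKeq]
    simpa using (hF.convex_le 0).inter (hG.convex_le 0)
  have hKcl : IsClosed K := by
    rw [hKeq]
    exact (isClosed_le hFc continuous_const).inter (isClosed_le hGc continuous_const)
  obtain ⟨z, hzK, hz⟩ := exists_minimiser_quadratic_growth hc p (R := fun _ => 0)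
    (convexOn_const 0 convex_univ) continuous_const (fun _ => le_rfl) hK hKconv hKcl
  simp only [add_zero] at hz
  have hmin : ∀ a b : ℝ, ∃ v, 0 ≤ a → 0 ≤ b → ∀ w,
      c * ‖v - p‖ ^ 2 + (b * G v + a * F v) + c / 2 * ‖w - v‖ ^ 2
        ≤ c * ‖w - p‖ ^ 2 + (b * G w + a * F w) := by
    intro a b
    by_cases hab : 0 ≤ a ∧ 0 ≤ b
    · obtain ⟨v, -, hv⟩ := exists_minimiser_quadratic_growth hc p
        (R := fun v => b * G v + a * F v) ((hG.smul hab.2).add (hF.smul hab.1)) (by fun_prop)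
        (fun v => add_nonneg (mul_nonneg hab.2 (hG0 v)) (mul_nonneg hab.1 (hF0 v)))
        univ_nonempty convex_univ isClosed_univ
      exact ⟨v, fun _ _ w => hv w (mem_univ w)⟩
    · exact ⟨0, fun ha hb => absurd ⟨ha, hb⟩ hab⟩
  choose U hU using hmin
  -- Clamping the weights at zero makes the minimal energy `M` monotone on all of `ℝ × ℝ`, not just
  -- eventually.
  set V : ℝ → ℝ → E := fun a b => U (max a 0) (max b 0) with hVdef
  set M : ℝ × ℝ → ℝ := fun w => c * ‖V w.1 w.2 - p‖ ^ 2
    + (max w.2 0 * G (V w.1 w.2) + max w.1 0 * F (V w.1 w.2)) with hM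
  have hV : ∀ (w : ℝ × ℝ) v, M w + c / 2 * ‖v - V w.1 w.2‖ ^ 2
      ≤ c * ‖v - p‖ ^ 2 + (max w.2 0 * G v + max w.1 0 * F v) := fun w v =>
    hU _ _ (le_max_right _ _) (le_max_right _ _) v
  have hgrow : ∀ w w' : ℝ × ℝ, w ≤ w' →
      M w + c / 2 * ‖V w'.1 w'.2 - V w.1 w.2‖ ^ 2 ≤ M w' := by
    -- The minimiser for `w'` is a competitor for `w`, and raising the weights only raises its
    -- energy.
    intro w w' hww
    refine (hV w _).trans ?_
    have h1 : max w.1 0 ≤ max w'.1 0 := max_le_max hww.1 le_rfl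
    have h2 : max w.2 0 ≤ max w'.2 0 := max_le_max hww.2 le_rfl
    have := mul_le_mul_of_nonneg_right h1 (hF0 (V w'.1 w'.2))
    have := mul_le_mul_of_nonneg_right h2 (hG0 (V w'.1 w'.2))
    simp only [hM]
    linarith
  have hMmono : Monotone M := fun w w' hww =>
    (le_add_of_nonneg_right (by positivity)).trans (hgrow w w' hww)
  obtain ⟨hzF, hzG⟩ := (hKmem z).1 hzK
  have hMle : ∀ w, M w ≤ c * ‖z - p‖ ^ 2 := fun w => by
    have h1 := hV w z
    rw [hzF, hzG] at h1
    have : 0 ≤ c / 2 * ‖z - V w.1 w.2‖ ^ 2 := by positivity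
    linarith
  have hbdd : BddAbove (range M) := ⟨_, by rintro _ ⟨w, rfl⟩; exact hMle w⟩
  have hMlim : Tendsto M atTop (𝓝 (⨆ w, M w)) := tendsto_atTop_ciSup hMmono hbdd
  have hcau : CauchySeq fun w : ℝ × ℝ => V w.1 w.2 := by
    refine cauchySeq_of_le_tendsto_0' (fun w => √(2 / c * ((⨆ w, M w) - M w))) ?_ ?_
    · intro w w' hww
      rw [dist_comm, dist_eq_norm]
      apply Real.le_sqrt_of_sq_le
      rw [div_mul_eq_mul_div, le_div_iff₀ hc]
      linarith [hgrow w w' hww, le_ciSup hbdd w']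
    · simpa using ((hMlim.const_sub (⨆ w, M w)).const_mul (2 / c)).sqrt
  obtain ⟨y, hy⟩ := cauchySeq_tendsto_of_complete hcau
  have hterms : ∀ w : ℝ × ℝ, 0 ≤ max w.2 0 * G (V w.1 w.2) ∧ 0 ≤ max w.1 0 * F (V w.1 w.2) :=
    fun w => ⟨mul_nonneg (le_max_right _ _) (hG0 _), mul_nonneg (le_max_right _ _) (hF0 _)⟩
  have hfst : Tendsto (fun w : ℝ × ℝ => w.1) atTop atTop := by
    rw [← prod_atTop_atTop_eq]; exact tendsto_fst
  have hsnd : Tendsto (fun w : ℝ × ℝ => w.2) atTop atTop := by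
    rw [← prod_atTop_atTop_eq]; exact tendsto_snd
  -- The energy bound gives `F ≤ c * ‖z - p‖ ^ 2 / w.1` along the minimisers, which vanishes in the
  -- limit.
  have hFy : F y ≤ 0 := by
    refine le_of_tendsto_of_tendsto ((hFc.tendsto y).comp hy)
      (hfst.const_div_atTop (c * ‖z - p‖ ^ 2)) ?_
    filter_upwards [hfst.eventually_gt_atTop 0] with w hw
    rw [Function.comp_apply, le_div_iff₀ hw, mul_comm]
    have h1 := hMle w
    have h2 := hterms w
    simp only [hM] at h1
    rw [max_eq_left hw.le] at h1
    have : 0 ≤ c * ‖V w.1 w.2 - p‖ ^ 2 := by positivity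
    linarith
  have hGy : G y ≤ 0 := by
    refine le_of_tendsto_of_tendsto ((hGc.tendsto y).comp hy)
      (hsnd.const_div_atTop (c * ‖z - p‖ ^ 2)) ?_
    filter_upwards [hsnd.eventually_gt_atTop 0] with w hw
    rw [Function.comp_apply, le_div_iff₀ hw, mul_comm]
    have h1 := hMle w
    have h2 := hterms w
    simp only [hM] at h1
    rw [max_eq_left hw.le] at h1
    have : 0 ≤ c * ‖V w.1 w.2 - p‖ ^ 2 := by positivity
    linarith
  have hyK : y ∈ K := by rw [hKeq]; exact ⟨hFy, hGy⟩
  have hyle : c * ‖y - p‖ ^ 2 ≤ c * ‖z - p‖ ^ 2 := by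
    have hcont : Continuous fun v : E => c * ‖v - p‖ ^ 2 := by fun_prop
    refine le_of_tendsto' ((hcont.tendsto y).comp hy) fun w => ?_
    have h1 := hMle w
    have h2 := hterms w
    simp only [hM] at h1
    simp only [Function.comp_apply]
    linarith
  -- `y` is admissible with energy at most that of `z`, so quadratic growth at `z` forces equality.
  have hyz : y = z := eq_of_half_mul_norm_sub_sq_le hc (by linarith [hz y hyK])
  refine ⟨V, fun a b ha hb w => ?_, z, hzK, hz, hyz ▸ hy⟩
  simpa only [hVdef, max_eq_left ha, max_eq_left hb] using hU a b ha hb w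

end Hilbert

/-! ### Completeness of the Sobolev space. -/

variable {n : ℕ} {Ω : Set (Eucl n)}

lemma lp_real_norm_sq {α : Type*} [MeasurableSpace α] {μ : Measure α} (g : Lp ℝ 2 μ) :
    ‖g‖ ^ 2 = ∫ x, g x ^ 2 ∂μ := by
  rw [← real_inner_self_eq_norm_sq, L2.inner_def]
  exact integral_congr_ae (Eventually.of_forall fun x => by simp [sq])

/-- For each test function, both sides of the weak gradient identity are continuous on the product,
being `L²` pairings with a fixed function. -/
lemma isClosed_sobolevH1 : IsClosed (sobolevH1 Ω : Set (WithLp 2 (L2 Ω × L2Vec Ω))) := by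
  have e : (sobolevH1 Ω : Set (WithLp 2 (L2 Ω × L2Vec Ω))) =
      ⋂ (φ : Eucl n → ℝ) (_ : ContDiff ℝ ∞ φ) (_ : HasCompactSupport φ) (_ : tsupport φ ⊆ Ω),
        {q | ∫ x in Ω, q.fst x • gradient φ x = -∫ x in Ω, φ x • q.snd x} := by
    ext q
    simp only [mem_iInter]
    rfl
  rw [e]
  refine isClosed_iInter fun φ => isClosed_iInter fun hφ => isClosed_iInter fun hc =>
    isClosed_iInter fun _ => ?_
  have h1 : Continuous (gradient φ) :=
    (InnerProductSpace.toDual ℝ (Eucl n)).symm.continuous.comp (hφ.continuous_fderiv (by simp))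
  have h2 : HasCompactSupport (gradient φ) :=
    (hc.fderiv (𝕜 := ℝ)).comp_left
      (g := (InnerProductSpace.toDual ℝ (Eucl n)).symm) (map_zero _)
  have hG : MemLp (gradient φ) 2 (volume.restrict Ω) := h1.memLp_of_hasCompactSupport h2
  have hΦ : MemLp φ 2 (volume.restrict Ω) := hφ.continuous.memLp_of_hasCompactSupport hc
  have hl : ∀ u : L2 Ω, ∫ x in Ω, u x • gradient φ x =
      (ContinuousLinearMap.lsmul ℝ ℝ (E := Eucl n)).lpPairing (volume.restrict Ω) 2 2 u
        (hG.toLp _) := fun u => by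
    rw [ContinuousLinearMap.lpPairing_eq_integral]
    refine integral_congr_ae ?_
    filter_upwards [hG.coeFn_toLp] with x hx
    simp [hx]
  have hr : ∀ g : L2Vec Ω, ∫ x in Ω, φ x • g x =
      (ContinuousLinearMap.lsmul ℝ ℝ (E := Eucl n)).lpPairing (volume.restrict Ω) 2 2
        (hΦ.toLp _) g := fun g => by
    rw [ContinuousLinearMap.lpPairing_eq_integral]
    refine integral_congr_ae ?_
    filter_upwards [hΦ.coeFn_toLp] with x hx
    simp [hx]
  simp only [hl, hr]
  have hfst : Continuous fun q : WithLp 2 (L2 Ω × L2Vec Ω) => q.fst := by fun_prop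
  have hsnd : Continuous fun q : WithLp 2 (L2 Ω × L2Vec Ω) => q.snd := by fun_prop
  exact isClosed_eq
    (((ContinuousLinearMap.lsmul ℝ ℝ (E := Eucl n)).lpPairing
      (volume.restrict Ω) 2 2).flip _ |>.continuous.comp hfst)
    (((ContinuousLinearMap.lsmul ℝ ℝ (E := Eucl n)).lpPairing
      (volume.restrict Ω) 2 2 _).continuous.comp hsnd).neg

instance completeSpace_sobolevH1 : CompleteSpace (H1 Ω) :=
  isClosed_sobolevH1.completeSpace_coe

/-- The inclusion `H¹(Ω) → L²(Ω)`. -/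
noncomputable def H1.fnCLM (Ω : Set (Eucl n)) : H1 Ω →L[ℝ] L2 Ω :=
  (WithLp.fstL 2 ℝ (L2 Ω) (L2Vec Ω)).comp (sobolevH1 Ω).subtypeL

lemma H1.fnCLM_apply (u : H1 Ω) : H1.fnCLM Ω u = u.fn := rfl

/-! ### Convexity, continuity and zero sets of the losses. -/

lemma obstacleLoss_eq_norm_sq (ψ u : H1 Ω) :
    obstacleLoss ψ u = ‖Lp.posPart (ψ.fn - u.fn)‖ ^ 2 := by
  rw [lp_real_norm_sq, obstacleLoss]
  refine integral_congr_ae ?_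
  filter_upwards [Lp.coeFn_posPart (ψ.fn - u.fn), Lp.coeFn_sub ψ.fn u.fn] with x h1 h2
  rw [h1, h2, Pi.sub_apply]

lemma boundaryLoss_eq_norm_sq (h : L2Boundary Ω) (u : H1 Ω) :
    boundaryLoss h u = ‖trace Ω u - h‖ ^ 2 := by
  rw [lp_real_norm_sq, boundaryLoss]
  refine integral_congr_ae ?_
  filter_upwards [Lp.coeFn_sub (trace Ω u) h] with x hx
  rw [hx, Pi.sub_apply]

lemma obstacleLoss_nonneg (ψ u : H1 Ω) : 0 ≤ obstacleLoss ψ u := by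
  rw [obstacleLoss_eq_norm_sq]; positivity

lemma boundaryLoss_nonneg (h : L2Boundary Ω) (u : H1 Ω) : 0 ≤ boundaryLoss h u := by
  rw [boundaryLoss_eq_norm_sq]; positivity

lemma continuous_obstacleLoss (ψ : H1 Ω) : Continuous (obstacleLoss ψ) := by
  have e : obstacleLoss ψ = fun u => ‖Lp.posPart (ψ.fn - H1.fnCLM Ω u)‖ ^ 2 :=
    funext (obstacleLoss_eq_norm_sq ψ)
  rw [e]
  exact ((Lp.continuous_posPart.comp
    (continuous_const.sub (H1.fnCLM Ω).continuous)).norm).pow 2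

lemma continuous_boundaryLoss (h : L2Boundary Ω) : Continuous (boundaryLoss h) := by
  rw [funext (boundaryLoss_eq_norm_sq h)]
  fun_prop

lemma convexOn_boundaryLoss (h : L2Boundary Ω) : ConvexOn ℝ univ (boundaryLoss h) := by
  rw [funext (boundaryLoss_eq_norm_sq h)]
  have h1 : ConvexOn ℝ univ fun g : L2Boundary Ω => ‖g - h‖ := by
    have h2 := (convexOn_univ_norm (E := L2Boundary Ω)).translate_left (-h)
    simp only [preimage_univ] at h2
    exact h2.congr fun g _ => by simp [sub_eq_add_neg]
  exact (h1.pow (fun _ _ => norm_nonneg _) 2).comp_linearMap (trace Ω).toLinearMap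

lemma convexOn_sq_max_sub (t : ℝ) : ConvexOn ℝ univ fun s : ℝ => max (t - s) 0 ^ 2 := by
  have h1 : ConvexOn ℝ univ fun s : ℝ => t - s :=
    (convexOn_const t convex_univ).sub (concaveOn_id convex_univ)
  exact (h1.sup (convexOn_const 0 convex_univ)).pow (fun _ _ => le_max_right _ _) 2

lemma integrable_obstacleLoss (ψ u : H1 Ω) :
    Integrable (fun x => max (ψ.fn x - u.fn x) 0 ^ 2) (volume.restrict Ω) := by
  have h1 := (Lp.memLp (Lp.posPart (ψ.fn - u.fn))).integrable_sq
  refine h1.congr ?_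
  filter_upwards [Lp.coeFn_posPart (ψ.fn - u.fn), Lp.coeFn_sub ψ.fn u.fn] with x h1 h2
  rw [h1, h2, Pi.sub_apply]

/-- The integrand is pointwise convex in the value of `u`; integrate the inequality. -/
lemma convexOn_obstacleLoss (ψ : H1 Ω) : ConvexOn ℝ univ (obstacleLoss ψ) := by
  refine ⟨convex_univ, fun u _ v _ a b ha hb hab => ?_⟩
  simp only [smul_eq_mul, obstacleLoss]
  rw [← integral_const_mul, ← integral_const_mul,
    ← integral_add ((integrable_obstacleLoss ψ u).const_mul a)
      ((integrable_obstacleLoss ψ v).const_mul b)]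
  refine integral_mono_ae (integrable_obstacleLoss ψ _)
    (((integrable_obstacleLoss ψ u).const_mul a).add ((integrable_obstacleLoss ψ v).const_mul b)) ?_
  have e : (a • u + b • v).fn = a • u.fn + b • v.fn := by
    simp only [← H1.fnCLM_apply, map_add, map_smul]
  rw [e]
  filter_upwards [Lp.coeFn_add (a • u.fn) (b • v.fn), Lp.coeFn_smul a u.fn,
    Lp.coeFn_smul b v.fn] with x h1 h2 h3
  have := (convexOn_sq_max_sub (ψ.fn x)).2 (mem_univ (u.fn x)) (mem_univ (v.fn x)) ha hb hab
  rw [h1, Pi.add_apply, h2, h3]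
  exact this

lemma mem_constraintSet_iff (ψ : H1 Ω) (h : L2Boundary Ω) (u : H1 Ω) :
    u ∈ constraintSet Ω ψ h ↔ obstacleLoss ψ u = 0 ∧ boundaryLoss h u = 0 := by
  refine and_congr ?_ ?_
  · rw [obstacleLoss, integral_eq_zero_iff_of_nonneg (fun x => sq_nonneg _)
      (integrable_obstacleLoss ψ u)]
    refine eventually_congr (Eventually.of_forall fun x => ?_)
    simp
  · rw [boundaryLoss_eq_norm_sq]
    simp [sub_eq_zero]

/-! ### The regularised Lagrangian and the main theorem. -/

/-- `lagr` is a continuous linear functional of `u - v`, and `lagrReg` is, up to a constant, a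
negative multiple of a squared distance. -/
lemma exists_lagrReg_eq_sub_sq (A : H1 Ω → DualH1 Ω) (f : L2 Ω) {γ : ℝ} (hγ : 0 < γ)
    (u : H1 Ω) : (∃ ℓ : DualH1 Ω, ∀ v, lagr A f u v = ℓ (u - v)) ∧
      ∃ (p : H1 Ω) (d : ℝ), ∀ v, lagrReg A f γ u v = d - 1 / (2 * γ) * ‖v - p‖ ^ 2 := by
  set ℓ : DualH1 Ω := A u - (innerSL ℝ f).comp (H1.fnCLM Ω) with hℓ
  have h1 : ∀ v, lagr A f u v = ℓ (u - v) := fun v => by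
    simp only [lagr, hℓ, sub_apply, ContinuousLinearMap.comp_apply,
      innerSL_apply_apply, L2.inner_def, H1.fnCLM_apply]
    congr 1
    exact integral_congr_ae (Eventually.of_forall fun x => by simp [mul_comm])
  refine ⟨⟨ℓ, h1⟩, ?_⟩
  set g := (InnerProductSpace.toDual ℝ (H1 Ω)).symm ℓ with hg
  have h2 : ∀ w, ℓ w = inner ℝ g w := fun w => by
    rw [hg, InnerProductSpace.toDual_symm_apply]
  refine ⟨u - γ • g, γ / 2 * ‖g‖ ^ 2, fun v => ?_⟩
  have e : v - (u - γ • g) = γ • g - (u - v) := by abel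
  rw [lagrReg, h1, h2, e, inner_sub_mul_norm_sq hγ]

end ObstacleVI

open ObstacleVI in
theorem mainTheorem5 {n : ℕ} (hn : 1 ≤ n) (Ω : Set (Eucl n)) (hΩ : IsBoundedLipschitzDomain Ω)
    -- the data of the obstacle problem
    (f : L2 Ω) (ψ : H1 Ω) (h : L2Boundary Ω) (hh : h ∈ HHalf Ω)
    (hψ : ∀ᵐ x ∂(surface Ω), trace Ω ψ x ≤ h x)
    -- the operator, Lipschitz and coercive on the constraint set
    (A : H1 Ω → DualH1 Ω) (Ca Cb : ℝ) (hCa : 0 < Ca) (hCb : 0 < Cb)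
    (hLip : ∀ u ∈ constraintSet Ω ψ h, ∀ v ∈ constraintSet Ω ψ h, ‖A u - A v‖ ≤ Cb * ‖u - v‖)
    (hcoer : ∀ u ∈ constraintSet Ω ψ h, ∀ v ∈ constraintSet Ω ψ h,
      Ca * ‖u - v‖ ^ 2 ≤ (A u - A v) (u - v))
    (γ : ℝ) (hγ : 1 / (2 * Ca) < γ)
    -- the solution of the variational inequality, and the auxiliary sets
    (uStar : H1 Ω) (hu : SolvesVI (constraintSet Ω ψ h) A f uStar)
    (X Y : Set (H1 Ω)) (huXY : uStar ∈ X ∩ Y)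
    (hXY : constraintSet Ω ψ h ∩ X ⊆ constraintSet Ω ψ h ∩ Y)
    (hconv : Convex ℝ (constraintSet Ω ψ h ∩ Y)) (hclosed : IsClosed (constraintSet Ω ψ h ∩ Y)) :
    ∃ vStar : ℝ → ℝ → H1 Ω,
      -- `vStar wo₂ wb₂` is the unique maximiser of `L_γ(u*, ·) - R₂` over `H¹(Ω)`
      (∀ wo₂ wb₂ : ℝ, 0 ≤ wo₂ → 0 ≤ wb₂ → ∀ v : H1 Ω,
        IsPenalisedMaximiser A f γ ψ h wo₂ wb₂ uStar v ↔ v = vStar wo₂ wb₂) ∧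
      -- the estimate
      (∀ ε > 0, ∃ α₀ > 0, ∀ wo₂ wb₂ : ℝ, α₀ ≤ min wo₂ wb₂ →
        ∀ (wo₁ wb₁ : ℝ) (Xt : Set (H1 Ω)), Xt.Nonempty →
          gapPen Xt A f γ ψ h wo₁ wb₁ wo₂ wb₂ uStar
              - gap (constraintSet Ω ψ h) Y A f γ uStar
            ≤ ε - 1 / (2 * γ) * ‖uStar - vStar wo₂ wb₂‖ ^ 2
                - penalty ψ h wo₂ wb₂ (vStar wo₂ wb₂)) ∧
      -- strong convergence to the unique maximiser of `L_γ(u*, ·)` over `K`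
      (∃ vHat : H1 Ω,
        (∀ v : H1 Ω, (v ∈ constraintSet Ω ψ h ∧
            IsMaxOn (lagrReg A f γ uStar) (constraintSet Ω ψ h) v) ↔ v = vHat) ∧
        Tendsto (fun w : ℝ × ℝ => vStar w.1 w.2) (atTop ×ˢ atTop) (𝓝 vHat)) ∧
      -- the rate of the constraint violation
      (∃ C : ℝ, ∀ α > 0, ∀ wo₂ wb₂ : ℝ, α ≤ min wo₂ wb₂ →
        √(obstacleLoss ψ (vStar wo₂ wb₂)) ≤ C / √α ∧
        √(boundaryLoss h (vStar wo₂ wb₂)) ≤ C / √α) := by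
  have hγ0 : 0 < γ := lt_trans (by positivity) hγ
  have hc : 0 < 1 / (2 * γ) := by positivity
  obtain ⟨⟨ℓ, hℓ⟩, p, d, hpd⟩ := exists_lagrReg_eq_sub_sq A f hγ0 uStar
  obtain ⟨V, hV, z, hzK, hz, hlim⟩ := exists_penalty_minimisers_tendsto hc p
    (convexOn_obstacleLoss ψ) (continuous_obstacleLoss ψ) (obstacleLoss_nonneg ψ)
    (convexOn_boundaryLoss h) (continuous_boundaryLoss h) (boundaryLoss_nonneg h)
    (mem_constraintSet_iff ψ h) ⟨uStar, hu.1⟩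
  have hreg0 : ∀ v ∈ constraintSet Ω ψ h, lagrReg A f γ uStar v ≤ 0 := fun v hv => by
    have := hu.2 v hv
    have : 0 ≤ 1 / (2 * γ) * ‖uStar - v‖ ^ 2 := by positivity
    rw [lagrReg]
    linarith
  -- The competitor `v = uStar` gives the value zero.
  have hgap : 0 ≤ gap (constraintSet Ω ψ h) Y A f γ uStar := by
    refine le_csSup ⟨0, ?_⟩ ⟨uStar, ⟨hu.1, huXY.2⟩, ?_⟩
    · rintro _ ⟨v, hv, rfl⟩
      exact hreg0 v hv.1
    · simp [lagrReg, hℓ]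
  have hpen : ∀ wo wb v, penalty ψ h wo wb v = wb * boundaryLoss h v + wo * obstacleLoss ψ v :=
    fun _ _ _ => rfl
  obtain ⟨huo, hub⟩ := (mem_constraintSet_iff ψ h uStar).1 hu.1
  obtain ⟨hzo, hzb⟩ := (mem_constraintSet_iff ψ h z).1 hzK
  refine ⟨V, ?_, ?_, ⟨z, ?_, ?_⟩, √(1 / (2 * γ) * ‖z - p‖ ^ 2), ?_⟩
  · intro wo wb hwo hwb v
    constructor
    · intro hv
      have h1 := isMaxOn_iff.1 hv (V wo wb) (mem_univ _)
      simp only [hpd, hpen] at h1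
      exact eq_of_half_mul_norm_sub_sq_le hc (by linarith [hV wo wb hwo hwb v])
    · rintro rfl
      refine isMaxOn_iff.2 fun w _ => ?_
      have h1 := hV wo wb hwo hwb w
      have : 0 ≤ 1 / (2 * γ) / 2 * ‖w - V wo wb‖ ^ 2 := by positivity
      simp only [hpd, hpen]
      linarith
  · intro ε hε
    have hcont : Tendsto (fun w : ℝ × ℝ => ℓ (uStar - V w.1 w.2)) atTop (𝓝 (ℓ (uStar - z))) :=
      (ℓ.continuous.tendsto _).comp (hlim.const_sub uStar)
    have hlt : ℓ (uStar - z) < ε := by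
      rw [← hℓ]
      exact (hu.2 z hzK).trans_lt hε
    obtain ⟨⟨a, b⟩, hab⟩ := eventually_atTop.1 (hcont.eventually_lt_const hlt)
    -- The `1` keeps the threshold positive and the weights nonnegative; `a` and `b` depend only on
    -- the convergence of `V`, hence not on `Xt` or the first pair of weights.
    refine ⟨max 1 (max a b), by positivity, fun wo wb hw wo₁ wb₁ Xt hXt => ?_⟩
    obtain ⟨hw1, hw2⟩ := le_min_iff.1 hw
    have hwo : 0 ≤ wo := zero_le_one.trans ((le_max_left _ _).trans hw1)
    have hwb : 0 ≤ wb := zero_le_one.trans ((le_max_left _ _).trans hw2)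
    have h1 : ℓ (uStar - V wo wb) < ε := hab (wo, wb)
      ⟨((le_max_left a b).trans (le_max_right _ _)).trans hw1,
        ((le_max_right a b).trans (le_max_right _ _)).trans hw2⟩
    -- The first penalty vanishes at `uStar`, and `V` maximises over the whole space, hence bounds
    -- the supremum over any `Xt`.
    have h2 : gapPen Xt A f γ ψ h wo₁ wb₁ wo wb uStar
        ≤ lagrReg A f γ uStar (V wo wb) - penalty ψ h wo wb (V wo wb) := by
      refine csSup_le (hXt.image _) ?_
      rintro _ ⟨v, -, rfl⟩
      have h3 := hV wo wb hwo hwb v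
      have : 0 ≤ 1 / (2 * γ) / 2 * ‖v - V wo wb‖ ^ 2 := by positivity
      simp only [hpd, hpen, huo, hub]
      linarith
    rw [lagrReg, hℓ] at h2
    linarith
  · intro v
    constructor
    · rintro ⟨hvK, hv⟩
      have h1 := isMaxOn_iff.1 hv z hzK
      simp only [hpd] at h1
      exact eq_of_half_mul_norm_sub_sq_le hc (by linarith [hz v hvK])
    · rintro rfl
      refine ⟨hzK, isMaxOn_iff.2 fun w hw => ?_⟩
      have h1 := hz w hw
      have : 0 ≤ 1 / (2 * γ) / 2 * ‖w - v‖ ^ 2 := by positivity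
      simp only [hpd]
      linarith
  · rwa [prod_atTop_atTop_eq]
  · intro α hα wo wb hw
    obtain ⟨hwo, hwb⟩ := le_min_iff.1 hw
    -- Tested at `z`, where both losses vanish, minimality bounds the total penalty by `1 / (2 * γ)
    -- * ‖z - p‖ ^ 2`, the square of the chosen constant.
    have h1 := hV wo wb (hα.le.trans hwo) (hα.le.trans hwb) z
    rw [hzo, hzb] at h1
    have hp1 : 0 ≤ 1 / (2 * γ) / 2 * ‖z - V wo wb‖ ^ 2 := by positivity
    have hp2 : 0 ≤ 1 / (2 * γ) * ‖V wo wb - p‖ ^ 2 := by positivity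
    have ho := obstacleLoss_nonneg ψ (V wo wb)
    have hb := boundaryLoss_nonneg h (V wo wb)
    have ho' := mul_le_mul_of_nonneg_right hwo ho
    have hb' := mul_le_mul_of_nonneg_right hwb hb
    have hαo := mul_nonneg hα.le ho
    have hαb := mul_nonneg hα.le hb
    rw [← Real.sqrt_div' _ hα.le]
    constructor <;> refine Real.sqrt_le_sqrt ?_ <;> rw [le_div_iff₀ hα] <;> linarith
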